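/- Let $\mathbb{H}$ be the quaternions. For $A\in\mathbb{H}^{M\times N}$ let $\sigma_1(A)\ge\sigma_2(A)\ge\dots\ge\sigma_{\min(M,N)}(A)\ge 0$ be its singular values (those of its $2M\times 2N$ complex representation, each of which occurs there twice, counted once), let the rank of $A$ be the maximal number of right linearly independent columns, and for $\varepsilon>0$ and $p\in[0,1]$ let $$\|A\|_L^p=\sum_{i=1}^{\min(M,N)}\log\bigl(\sigma_i(A)^p+\varepsilon\bigr).$$ Let $\varepsilon>0$, let $d\le\min(M,N)$, and let $X\in\mathbb{H}^{M\times N}$ have rank at most $d$. Then $X=UV^H$ for some $U\in\mathbb{H}^{M\times d}$, $V\in\mathbb{H}^{N\times d}$, the minimum below is attained, and $$\min_{\substack{U\in\mathbb{H}^{M\times d},\,V\in\mathbb{H}^{N\times d}\\ X=UV^H}}\Bigl(\tfrac12\|U\|_L^1+\tfrac12\|V\|_L^1\Bigr)=\sum_{i=1}^{d}\log\bigl(\sigma_i(X)^{1/2}+\varepsilon\bigr)=\|X\|_L^{1/2}-(\min(M,N)-d)\log\varepsilon .$$ That is, the minimum is the logarithmic norm $\|X\|_L^{1/2}$ taken over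 the first $\min(M,N,d)=d$ singular values of $X$; it equals $\|X\|_L^{1/2}$ itself when $d=\min(M,N)$ or $\varepsilon=1$. Moreover $X$ has a quaternion singular value decomposition $X=A\Lambda B^H$, with $A\in\mathbb{H}^{M\times M}$ and $B\in\mathbb{H}^{N\times N}$ unitary and $\Lambda\in\mathbb{R}^{M\times N}$ diagonal with nonnegative, nonincreasing diagonal entries $s_1\ge s_2\ge\cdots$; and for every such decomposition the balanced factors $U_\star=A\Sigma_{M\times d}^{1/2}$ and $V_\star=B\Sigma_{N\times d}^{1/2}$, where $\Sigma_{m\times d}^{1/2}$ is the $m\times d$ diagonal matrix with entries $s_1^{1/2},\dots,s_d^{1/2}$, satisfy $X=U_\star V_\star^H$ and attain the minimum. -/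

import Mathlib

open scoped Quaternion Matrix

noncomputable section

/-- The complex representation of a quaternion matrix: writing `A = Aₚ + A_q j` with
`Aₚ = A₀ + A₁ i` and `A_q = A₂ + A₃ i`, it is the block matrix
`[[Aₚ, A_q], [-conj A_q, conj Aₚ]]`. -/
def complexRep {M N : ℕ} (A : Matrix (Fin M) (Fin N) ℍ[ℝ]) :
    Matrix (Fin M ⊕ Fin M) (Fin N ⊕ Fin N) ℂ :=
  Matrix.fromBlocks
    (A.map fun q => (⟨q.re, q.imI⟩ : ℂ)) (A.map fun q => (⟨q.imJ, q.imK⟩ : ℂ))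
    (A.map fun q => -star (⟨q.imJ, q.imK⟩ : ℂ)) (A.map fun q => star (⟨q.re, q.imI⟩ : ℂ))

/-- The singular values of a quaternion matrix in nonincreasing order, indexed from `0`.
Each of them occurs twice among the singular values of the complex representation, so every
second one of those is taken. -/
def quatSingularValue {M N : ℕ} (A : Matrix (Fin M) (Fin N) ℍ[ℝ]) (i : ℕ) : ℝ :=
  (Matrix.toEuclideanLin (complexRep A)).singularValues (2 * i)

/-- The rank of a quaternion matrix: the maximal number of right linearly independent columns,
i.e. the dimension of the right column space. (`ℍᵐᵒᵖ` acts by right multiplication.) -/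
def quatRank {M N : ℕ} (A : Matrix (Fin M) (Fin N) ℍ[ℝ]) : ℕ :=
  Module.finrank ℍ[ℝ]ᵐᵒᵖ (Submodule.span ℍ[ℝ]ᵐᵒᵖ (Set.range A.col))

/-- The part of the logarithmic norm that comes from the `K` largest singular values:
`∑_{i=1}^{K} log (σ_i(A)^p + ε)`. -/
def leadingLogNorm (K : ℕ) (p ε : ℝ) {M N : ℕ} (A : Matrix (Fin M) (Fin N) ℍ[ℝ]) : ℝ :=
  ∑ i ∈ Finset.range K, Real.log (quatSingularValue A i ^ p + ε)

/-- The quaternion logarithmic norm `‖A‖_L^p = ∑_{i=1}^{min(M,N)} log (σ_i(A)^p + ε)`. -/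
def quatLogNorm (p ε : ℝ) {M N : ℕ} (A : Matrix (Fin M) (Fin N) ℍ[ℝ]) : ℝ :=
  leadingLogNorm (min M N) p ε A

/-- The rectangular diagonal quaternion matrix with the real diagonal entries `s 0, s 1, …`. -/
def rectDiagonal (M N : ℕ) (s : ℕ → ℝ) : Matrix (Fin M) (Fin N) ℍ[ℝ] :=
  Matrix.of fun i j => if (i : ℕ) = (j : ℕ) then ((s i : ℝ) : ℍ[ℝ]) else 0

/-- `X = A Λ Bᴴ` is a quaternion singular value decomposition: `A` and `B` are unitary and `Λ` is
diagonal with real nonnegative entries in nonincreasing order. (Entries of the sequence `s` from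
position `min M N` on do not occur in `Λ`.) -/
structure IsQSVD {M N : ℕ} (X : Matrix (Fin M) (Fin N) ℍ[ℝ]) (A : Matrix (Fin M) (Fin M) ℍ[ℝ])
    (s : ℕ → ℝ) (B : Matrix (Fin N) (Fin N) ℍ[ℝ]) : Prop where
  unitary_left : A ∈ unitary (Matrix (Fin M) (Fin M) ℍ[ℝ])
  unitary_right : B ∈ unitary (Matrix (Fin N) (Fin N) ℍ[ℝ])
  antitone : Antitone s
  nonneg : ∀ i, 0 ≤ s i
  eq_mul : X = A * rectDiagonal M N s * Bᴴ

end

theorem Matrix.det_mul_eq_sum_prod_mul_det {m n R : Type*} [Fintype m] [DecidableEq m]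
    [Fintype n] [DecidableEq n] [CommRing R] (P : Matrix m n R) (Q : Matrix n m R) :
    (P * Q).det = ∑ f : m → n, (∏ i, P i (f i)) * (Q.submatrix f id).det := by
  have h : (P * Q) = fun i => ∑ l, P i l • Q l := by
    ext i j; simp [Matrix.mul_apply, Finset.sum_apply]
  have h2 : (P * Q).det = Matrix.detRowAlternating (R := R) (P * Q) := rfl
  rw [h2, h]
  have := (Matrix.detRowAlternating (R := R) (n := m)).toMultilinearMap.map_sum
    (fun i (l : n) => P i l • Q l)
  erw [this]
  refine Finset.sum_congr rfl fun f _ => ?_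
  have := (Matrix.detRowAlternating (R := R) (n := m)).toMultilinearMap.map_smul_univ
    (fun i => P i (f i)) (fun i => Q (f i))
  erw [this]
  rfl

/-- A form of the Cauchy–Binet formula: each minor is counted once for every ordering. -/
theorem Matrix.factorial_mul_det_mul {m n R : Type*} [Fintype m] [DecidableEq m]
    [Fintype n] [DecidableEq n] [CommRing R] (P : Matrix m n R) (Q : Matrix n m R) :
    ((Fintype.card m).factorial : R) * (P * Q).det
      = ∑ f : m → n, (P.submatrix id f).det * (Q.submatrix f id).det := by
  have key : ∀ σ : Equiv.Perm m, (P * Q).det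
      = ∑ f : m → n, (Equiv.Perm.sign σ : R) * (∏ i, P i (f (σ i))) * (Q.submatrix f id).det := by
    intro σ
    rw [Matrix.det_mul_eq_sum_prod_mul_det]
    refine (Fintype.sum_equiv (Equiv.arrowCongr σ (Equiv.refl n)).symm _ _ fun f => ?_).symm
    have h1 : Q.submatrix ((Equiv.arrowCongr σ (Equiv.refl n)).symm f) id
        = (Q.submatrix f id).submatrix σ id := by
      ext i j; simp [Equiv.arrowCongr]
    rw [h1, Matrix.det_permute]
    simp [Equiv.arrowCongr]
    ring
  have : ((Fintype.card m).factorial : R) * (P * Q).det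
      = ∑ σ : Equiv.Perm m, (P * Q).det := by
    simp [Fintype.card_perm]
  rw [this, Finset.sum_congr rfl fun σ _ => key σ, Finset.sum_comm]
  refine Finset.sum_congr rfl fun f _ => ?_
  rw [← Finset.sum_mul, ← Matrix.det_transpose (P.submatrix id f),
    Matrix.det_apply' (P.submatrix id f)ᵀ]
  simp

theorem Matrix.det_conjTranspose_mul_diagonal_mul_le {m n 𝕜 : Type*} [Fintype m] [DecidableEq m]
    [Fintype n] [DecidableEq n] [RCLike 𝕜] (Z : Matrix n m 𝕜) (a : n → ℝ) (C : ℝ)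
    (hC : ∀ f : m → n, Function.Injective f → ∏ i, a (f i) ≤ C) :
    RCLike.re (Zᴴ * Matrix.diagonal (fun i => (a i : 𝕜)) * Z).det
      ≤ C * RCLike.re (Zᴴ * Z).det := by
  have key : ∀ b : n → ℝ, ((Fintype.card m).factorial : ℝ) *
      RCLike.re (Zᴴ * Matrix.diagonal (fun i => (b i : 𝕜)) * Z).det
      = ∑ f : m → n, (∏ i, b (f i)) * ‖(Z.submatrix f id).det‖ ^ 2 := by
    intro b
    have h := Matrix.factorial_mul_det_mul (Zᴴ * Matrix.diagonal (fun i => (b i : 𝕜))) Z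
    have h2 : ∀ f : m → n,
        ((Zᴴ * Matrix.diagonal (fun i => (b i : 𝕜))).submatrix id f).det * (Z.submatrix f id).det
        = (((∏ i, b (f i)) * ‖(Z.submatrix f id).det‖ ^ 2 : ℝ) : 𝕜) := by
      intro f
      have h3 : (Zᴴ * Matrix.diagonal (fun i => (b i : 𝕜))).submatrix id f
          = (Z.submatrix f id)ᴴ * Matrix.diagonal (fun i => (b (f i) : 𝕜)) := by
        ext i j; simp [Matrix.mul_diagonal]
      rw [h3, Matrix.det_mul, Matrix.det_conjTranspose, Matrix.det_diagonal]
      push_cast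
      rw [← RCLike.conj_mul]
      simp only [starRingEnd_apply]
      ring
    rw [Finset.sum_congr rfl fun f _ => h2 f] at h
    have h4 := congrArg (RCLike.re (K := 𝕜)) h
    rw [← RCLike.ofReal_natCast, RCLike.re_ofReal_mul, ← RCLike.ofReal_sum,
      RCLike.ofReal_re] at h4
    exact h4
  have hfac : (0 : ℝ) < (Fintype.card m).factorial := by positivity
  have k1 := key a
  have k2 := key 1
  simp only [Pi.one_apply, RCLike.ofReal_one, Matrix.diagonal_one, Matrix.mul_one,
    Finset.prod_const_one, one_mul] at k2
  rw [← mul_le_mul_iff_right₀ hfac, k1, mul_left_comm, k2, Finset.mul_sum]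
  refine Finset.sum_le_sum fun f _ => ?_
  by_cases hf : Function.Injective f
  · exact mul_le_mul_of_nonneg_right (hC f hf) (by positivity)
  · obtain ⟨i, j, hij, hne⟩ : ∃ i j, f i = f j ∧ i ≠ j := by
      simpa [Function.Injective] using hf
    have : (Z.submatrix f id).det = 0 :=
      Matrix.det_zero_of_row_eq hne (by ext l; simp [hij])
    simp [this]

theorem Antitone.prod_comp_le_prod_range {s : ℕ → ℝ} (hs : Antitone s) (h0 : ∀ i, 0 ≤ s i)
    {k : ℕ} (f : Fin k → ℕ) (hf : Function.Injective f) :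
    ∏ i, s (f i) ≤ ∏ i ∈ Finset.range k, s i := by
  have hcard : (Finset.univ.image f).card = k := by
    simp [Finset.card_image_of_injective _ hf]
  have h1 : ∏ i, s (f i) = ∏ i : Fin k, s ((Finset.univ.image f).orderEmbOfFin hcard i) := by
    rw [← Finset.prod_image (s := Finset.univ) (g := f) (f := s) (fun _ _ _ _ h => hf h),
      ← Finset.prod_image (s := Finset.univ)
        (g := (Finset.univ.image f).orderEmbOfFin hcard) (f := s)
        (fun _ _ _ _ h => (RelEmbedding.injective _) h), Finset.image_orderEmbOfFin_univ]
  rw [h1, ← Fin.prod_univ_eq_prod_range]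
  refine Finset.prod_le_prod (fun _ _ => h0 _) fun i _ => hs ?_
  have hm : StrictMono ((Finset.univ.image f).orderEmbOfFin hcard) := OrderEmbedding.strictMono _
  clear * - hm
  obtain ⟨i, hi⟩ := i
  induction i with
  | zero => exact Nat.zero_le _
  | succ i ih =>
    exact Nat.succ_le_of_lt (lt_of_le_of_lt (ih (by omega)) (hm (Fin.mk_lt_mk.2 (Nat.lt_succ_self i))))

namespace LinearMap

variable {𝕜 E F G : Type*} [RCLike 𝕜]
  [NormedAddCommGroup E] [InnerProductSpace 𝕜 E] [FiniteDimensional 𝕜 E]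
  [NormedAddCommGroup F] [InnerProductSpace 𝕜 F] [FiniteDimensional 𝕜 F]
  [NormedAddCommGroup G] [InnerProductSpace 𝕜 G] [FiniteDimensional 𝕜 G]

theorem det_gram_comp_le (T : E →ₗ[𝕜] F) {k : ℕ} (v : Fin k → E) :
    RCLike.re (Matrix.gram 𝕜 (T ∘ v)).det
      ≤ (∏ i ∈ Finset.range k, T.singularValues i) ^ 2 * RCLike.re (Matrix.gram 𝕜 v).det := by
  set b := T.isSymmetric_adjoint_comp_self.eigenvectorBasis rfl with hb
  set Z : Matrix (Fin (Module.finrank 𝕜 E)) (Fin k) 𝕜 := b.toBasis.toMatrix v with hZ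
  have h1 : Matrix.gram 𝕜 v = Zᴴ * Z := Matrix.gram_eq_conjTranspose_mul b v
  have h2 : Matrix.gram 𝕜 (T ∘ v)
      = Zᴴ * Matrix.diagonal (fun i : Fin (Module.finrank 𝕜 E) =>
        ((T.singularValues i ^ 2 : ℝ) : 𝕜)) * Z := by
    ext i j
    rw [Matrix.gram_apply, Function.comp_apply, Function.comp_apply, ← LinearMap.adjoint_inner_right,
      ← b.sum_inner_mul_inner, Matrix.mul_apply]
    refine Finset.sum_congr rfl fun l _ => ?_
    have h3 := T.isSymmetric_adjoint_comp_self.eigenvectorBasis_apply_self_apply rfl (v j) l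
    rw [← hb, b.repr_apply_apply, b.repr_apply_apply, ← T.sq_singularValues_fin] at h3
    simp only [LinearMap.comp_apply] at h3
    rw [h3, Matrix.mul_diagonal, Matrix.conjTranspose_apply]
    simp only [hZ, Module.Basis.toMatrix_apply, OrthonormalBasis.coe_toBasis_repr_apply,
      b.repr_apply_apply]
    rw [← starRingEnd_apply, inner_conj_symm]
    ring
  rw [h1, h2]
  refine Matrix.det_conjTranspose_mul_diagonal_mul_le Z _ _ fun f hf => ?_
  rw [Finset.prod_pow]
  refine pow_le_pow_left₀ (Finset.prod_nonneg fun _ _ => T.singularValues_nonneg _) ?_ 2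
  exact T.singularValues_antitone.prod_comp_le_prod_range T.singularValues_nonneg
    (fun i => (f i : ℕ)) (Fin.val_injective.comp hf)

theorem exists_det_gram_comp_eq (T : E →ₗ[𝕜] F) {k : ℕ} (hk : k ≤ Module.finrank 𝕜 E) :
    ∃ v : Fin k → E, Matrix.gram 𝕜 v = 1 ∧ RCLike.re (Matrix.gram 𝕜 (T ∘ v)).det
      = (∏ i ∈ Finset.range k, T.singularValues i) ^ 2 := by
  set b := T.isSymmetric_adjoint_comp_self.eigenvectorBasis rfl with hb
  refine ⟨fun i => b (Fin.castLE hk i), ?_, ?_⟩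
  · exact Matrix.gram_eq_one_iff_orthonormal.2 (b.orthonormal.comp _ (Fin.castLE_injective hk))
  · have : Matrix.gram 𝕜 (T ∘ fun i => b (Fin.castLE hk i))
        = Matrix.diagonal (fun i : Fin k => ((T.singularValues i ^ 2 : ℝ) : 𝕜)) := by
      ext i j
      rw [Matrix.gram_apply, Function.comp_apply, Function.comp_apply,
        ← LinearMap.adjoint_inner_right, ← LinearMap.comp_apply,
        hb, LinearMap.IsSymmetric.apply_eigenvectorBasis, ← hb, inner_smul_right,
        ← T.sq_singularValues_fin, b.inner_eq_ite, Matrix.diagonal_apply]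
      by_cases h : i = j <;> simp [h]
    rw [this, Matrix.det_diagonal, ← RCLike.ofReal_prod, RCLike.ofReal_re, Finset.prod_pow,
      Fin.prod_univ_eq_prod_range (fun i => T.singularValues i)]

/-- **Horn's inequality** for the singular values of a composition. -/
theorem prod_singularValues_comp_le (S : F →ₗ[𝕜] G) (T : E →ₗ[𝕜] F) (k : ℕ) :
    ∏ i ∈ Finset.range k, (S ∘ₗ T).singularValues i
      ≤ (∏ i ∈ Finset.range k, S.singularValues i) *
        ∏ i ∈ Finset.range k, T.singularValues i := by
  have hS : 0 ≤ ∏ i ∈ Finset.range k, S.singularValues i :=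
    Finset.prod_nonneg fun _ _ => S.singularValues_nonneg _
  have hT : 0 ≤ ∏ i ∈ Finset.range k, T.singularValues i :=
    Finset.prod_nonneg fun _ _ => T.singularValues_nonneg _
  rcases le_or_gt k (Module.finrank 𝕜 E) with hk | hk
  · obtain ⟨v, hv, hd⟩ := exists_det_gram_comp_eq (S ∘ₗ T) hk
    have h1 := det_gram_comp_le S (T ∘ v)
    have h2 := det_gram_comp_le T v
    rw [hv, Matrix.det_one, RCLike.one_re, mul_one] at h2
    refine le_of_sq_le_sq ?_ (mul_nonneg hS hT)
    rw [← hd, mul_pow]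
    exact h1.trans (mul_le_mul_of_nonneg_left h2 (sq_nonneg _))
  · rw [Finset.prod_eq_zero (Finset.mem_range.2 hk)
      ((S ∘ₗ T).singularValues_of_finrank_le le_rfl)]
    exact mul_nonneg hS hT

end LinearMap

theorem Real.mul_log_sub_log_le {x y ε : ℝ} (hx : 0 < x) (hy : 0 < y) (hε : 0 < ε) :
    x / (x + ε) * (Real.log y - Real.log x) ≤ Real.log (y + ε) - Real.log (x + ε) := by
  have h := strictConcaveOn_log_Ioi.concaveOn.2
    (Set.mem_Ioi.2 (div_pos hy hx)) (Set.mem_Ioi.2 one_pos)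
    (show 0 ≤ x / (x + ε) by positivity) (show 0 ≤ ε / (x + ε) by positivity)
    (show x / (x + ε) + ε / (x + ε) = 1 by field_simp)
  simp only [smul_eq_mul] at h
  have e : x / (x + ε) * (y / x) + ε / (x + ε) * 1 = (y + ε) / (x + ε) := by field_simp
  rw [e, Real.log_one, mul_zero, add_zero, Real.log_div hy.ne' hx.ne',
    Real.log_div (by positivity) (by positivity)] at h
  exact h

theorem Finset.sum_range_mul_nonneg_of_antitone {w c : ℕ → ℝ} (hw : Antitone w)
    (hw0 : ∀ i, 0 ≤ w i) {n : ℕ} (hc : ∀ k ≤ n, 0 ≤ ∑ i ∈ Finset.range k, c i) :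
    0 ≤ ∑ i ∈ Finset.range n, w i * c i := by
  have key : ∀ k, k + 1 ≤ n → w k * ∑ i ∈ Finset.range (k + 1), c i
      ≤ ∑ i ∈ Finset.range (k + 1), w i * c i := by
    intro k
    induction k with
    | zero => intro _; simp
    | succ k ih =>
      intro hk
      rw [Finset.sum_range_succ, Finset.sum_range_succ _ (k + 1), mul_add]
      have h1 := ih (by omega)
      have h2 := mul_le_mul_of_nonneg_right (hw (Nat.le_succ k)) (hc (k + 1) (by omega))
      simp only [Nat.succ_eq_add_one] at h2
      linarith
  cases n with
  | zero => simp
  | succ n => exact (mul_nonneg (hw0 n) (hc _ le_rfl)).trans (key n le_rfl)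

theorem Finset.sum_log_add_le_of_prod_le {x y : ℕ → ℝ} (hx : Antitone x) (hx0 : ∀ i, 0 ≤ x i)
    (hy0 : ∀ i, 0 ≤ y i) {ε : ℝ} (hε : 0 < ε) {n : ℕ}
    (h : ∀ k ≤ n, ∏ i ∈ Finset.range k, x i ≤ ∏ i ∈ Finset.range k, y i) :
    ∑ i ∈ Finset.range n, Real.log (x i + ε) ≤ ∑ i ∈ Finset.range n, Real.log (y i + ε) := by
  have hprod : ∀ k ≤ n, (∀ i < k, 0 < x i) → ∀ i < k, 0 < y i := by
    intro k hk hxk i hi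
    have : 0 < ∏ i ∈ Finset.range k, y i :=
      (Finset.prod_pos fun i hi => hxk i (Finset.mem_range.1 hi)).trans_le (h k hk)
    exact (hy0 i).lt_of_ne' fun h0 =>
      this.ne' (Finset.prod_eq_zero (Finset.mem_range.2 hi) h0)
  have hpos : ∀ k, 0 < x k → ∀ i < k + 1, 0 < x i := fun k hk i hi =>
    hk.trans_le (hx (by omega))
  let c : ℕ → ℝ := fun i => if 0 < x i then Real.log (y i) - Real.log (x i) else 0
  have hc : ∀ k ≤ n, 0 ≤ ∑ i ∈ Finset.range k, c i := by
    intro k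
    induction k with
    | zero => simp
    | succ k ih =>
      intro hk
      by_cases hxk : 0 < x k
      · have hxp := hpos k hxk
        have hyp := hprod _ hk hxp
        have : ∑ i ∈ Finset.range (k + 1), c i
            = ∑ i ∈ Finset.range (k + 1), (Real.log (y i) - Real.log (x i)) :=
          Finset.sum_congr rfl fun i hi => by simp [c, hxp i (Finset.mem_range.1 hi)]
        rw [this, Finset.sum_sub_distrib,
          ← Real.log_prod fun i hi => (hyp i (Finset.mem_range.1 hi)).ne',
          ← Real.log_prod fun i hi => (hxp i (Finset.mem_range.1 hi)).ne', sub_nonneg]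
        exact Real.log_le_log (Finset.prod_pos fun i hi => hxp i (Finset.mem_range.1 hi)) (h _ hk)
      · rw [Finset.sum_range_succ]
        simpa [c, hxk] using ih (by omega)
  have hw : Antitone fun i => x i / (x i + ε) := by
    intro i j hij
    have hi := hx0 i
    have hj := hx0 j
    have := hx hij
    simp only
    rw [div_le_div_iff₀ (by positivity) (by positivity)]
    nlinarith
  have hmain := Finset.sum_range_mul_nonneg_of_antitone hw
    (fun i => div_nonneg (hx0 i) (add_nonneg (hx0 i) hε.le)) hc
  rw [← sub_nonneg, ← Finset.sum_sub_distrib]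
  refine hmain.trans (Finset.sum_le_sum fun i hi => ?_)
  by_cases hxi : 0 < x i
  · have hyi := hprod (i + 1) (Finset.mem_range.1 hi) (hpos i hxi) i (Nat.lt_succ_self i)
    simpa [c, hxi] using Real.mul_log_sub_log_le hxi hyi hε
  · have h0 : x i = 0 := le_antisymm (not_lt.1 hxi) (hx0 i)
    simp only [c, h0, lt_irrefl, if_false, mul_zero, zero_add, sub_nonneg]
    exact Real.log_le_log hε (by linarith [hy0 i])

theorem Real.log_sqrt_mul_add_le {u v ε : ℝ} (hu : 0 ≤ u) (hv : 0 ≤ v) (hε : 0 < ε) :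
    Real.log (√(u * v) + ε) ≤ 1 / 2 * Real.log (u + ε) + 1 / 2 * Real.log (v + ε) := by
  have h : Real.log ((√(u * v) + ε) ^ 2) ≤ Real.log ((u + ε) * (v + ε)) := by
    refine Real.log_le_log (by positivity) ?_
    have h1 : √(u * v) ^ 2 = u * v := Real.sq_sqrt (mul_nonneg hu hv)
    have h2 : 2 * √(u * v) ≤ u + v := by
      rw [Real.sqrt_mul hu]
      nlinarith [sq_nonneg (√u - √v), Real.sq_sqrt hu, Real.sq_sqrt hv]
    nlinarith
  rw [Real.log_pow, Real.log_mul (by positivity) (by positivity)] at h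
  push_cast at h
  linarith

theorem Finset.sum_log_sqrt_add_le_of_prod_le {x u v : ℕ → ℝ} (hx : Antitone x)
    (hx0 : ∀ i, 0 ≤ x i) (hu0 : ∀ i, 0 ≤ u i) (hv0 : ∀ i, 0 ≤ v i) {ε : ℝ} (hε : 0 < ε) {n : ℕ}
    (h : ∀ k ≤ n, ∏ i ∈ Finset.range k, x i
      ≤ (∏ i ∈ Finset.range k, u i) * ∏ i ∈ Finset.range k, v i) :
    ∑ i ∈ Finset.range n, Real.log (√(x i) + ε)
      ≤ 1 / 2 * ∑ i ∈ Finset.range n, Real.log (u i + ε)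
        + 1 / 2 * ∑ i ∈ Finset.range n, Real.log (v i + ε) := by
  have hprod : ∀ (z : ℕ → ℝ), (∀ i, 0 ≤ z i) → ∀ k,
      ∏ i ∈ Finset.range k, √(z i) = √(∏ i ∈ Finset.range k, z i) := by
    intro z hz k
    rw [Real.sqrt_prod]
    exact fun i _ => hz i
  refine (Finset.sum_log_add_le_of_prod_le (y := fun i => √(u i * v i))
    (fun i j hij => Real.sqrt_le_sqrt (hx hij)) (fun _ => Real.sqrt_nonneg _)
    (fun _ => Real.sqrt_nonneg _) hε fun k hk => ?_).trans ?_
  · rw [hprod x hx0, hprod _ fun i => mul_nonneg (hu0 i) (hv0 i), Finset.prod_mul_distrib]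
    exact Real.sqrt_le_sqrt (h k hk)
  · rw [Finset.mul_sum, Finset.mul_sum, ← Finset.sum_add_distrib]
    exact Finset.sum_le_sum fun i _ => Real.log_sqrt_mul_add_le (hu0 i) (hv0 i) hε

theorem complexRep_mul {L M N : ℕ} (A : Matrix (Fin L) (Fin M) ℍ[ℝ])
    (B : Matrix (Fin M) (Fin N) ℍ[ℝ]) :
    complexRep (A * B) = complexRep A * complexRep B := by
  have hre : ∀ f : Fin M → ℍ[ℝ], (∑ i, f i).re = ∑ i, (f i).re := fun f =>
    map_sum (QuaternionAlgebra.reₗ (-1 : ℝ) 0 (-1)) f _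
  have hi : ∀ f : Fin M → ℍ[ℝ], (∑ i, f i).imI = ∑ i, (f i).imI := fun f =>
    map_sum (QuaternionAlgebra.imIₗ (-1 : ℝ) 0 (-1)) f _
  have hj : ∀ f : Fin M → ℍ[ℝ], (∑ i, f i).imJ = ∑ i, (f i).imJ := fun f =>
    map_sum (QuaternionAlgebra.imJₗ (-1 : ℝ) 0 (-1)) f _
  have hk : ∀ f : Fin M → ℍ[ℝ], (∑ i, f i).imK = ∑ i, (f i).imK := fun f =>
    map_sum (QuaternionAlgebra.imKₗ (-1 : ℝ) 0 (-1)) f _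
  ext i j
  rcases i with i | i <;> rcases j with j | j <;>
  · simp only [complexRep, Matrix.fromBlocks_apply₁₁, Matrix.fromBlocks_apply₁₂,
      Matrix.fromBlocks_apply₂₁, Matrix.fromBlocks_apply₂₂, Matrix.map_apply, Matrix.mul_apply,
      Fintype.sum_sum_type, hre, hi, hj, hk, ← Finset.sum_add_distrib]
    apply Complex.ext <;>
    · simp only [Complex.re_sum, Complex.im_sum, Complex.star_def, Complex.conj_re,
        Complex.conj_im, Complex.neg_re, Complex.neg_im, Complex.add_re, Complex.add_im,
        Complex.mul_re, Complex.mul_im, Quaternion.re_mul, Quaternion.imI_mul, Quaternion.imJ_mul,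
        Quaternion.imK_mul, ← Finset.sum_neg_distrib]
      refine Finset.sum_congr rfl fun l _ => ?_
      ring

theorem complexRep_conjTranspose {M N : ℕ} (A : Matrix (Fin M) (Fin N) ℍ[ℝ]) :
    complexRep Aᴴ = (complexRep A)ᴴ := by
  ext i j
  rcases i with i | i <;> rcases j with j | j <;>
  · simp only [complexRep, Matrix.fromBlocks_apply₁₁, Matrix.fromBlocks_apply₁₂,
      Matrix.fromBlocks_apply₂₁, Matrix.fromBlocks_apply₂₂, Matrix.map_apply,
      Matrix.conjTranspose_apply]
    apply Complex.ext <;> simp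

theorem complexRep_diagonal {N : ℕ} (t : Fin N → ℝ) :
    complexRep (Matrix.diagonal fun i => ((t i : ℝ) : ℍ[ℝ]))
      = Matrix.diagonal (Sum.elim (fun i => (t i : ℂ)) (fun i => (t i : ℂ))) := by
  ext i j
  rcases i with i | i <;> rcases j with j | j <;>
  · simp only [complexRep, Matrix.fromBlocks_apply₁₁, Matrix.fromBlocks_apply₁₂,
      Matrix.fromBlocks_apply₂₁, Matrix.fromBlocks_apply₂₂, Matrix.map_apply,
      Matrix.diagonal_apply]
    by_cases h : i = j <;> apply Complex.ext <;> simp [h]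

theorem rectDiagonal_conjTranspose (M N : ℕ) (s : ℕ → ℝ) :
    (rectDiagonal M N s)ᴴ = rectDiagonal N M s := by
  ext1 i j
  rw [Matrix.conjTranspose_apply]
  simp only [rectDiagonal, Matrix.of_apply]
  by_cases h : (i : ℕ) = j
  · simp [h]
  · rw [if_neg h, if_neg (Ne.symm h), star_zero]

theorem rectDiagonal_mul (M K N : ℕ) (s t : ℕ → ℝ) :
    rectDiagonal M K s * rectDiagonal K N t
      = rectDiagonal M N fun i => if i < K then s i * t i else 0 := by
  ext1 i j
  simp only [rectDiagonal, Matrix.mul_apply, Matrix.of_apply]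
  by_cases hi : (i : ℕ) < K
  · rw [Finset.sum_eq_single (⟨i, hi⟩ : Fin K)]
    · by_cases h : (i : ℕ) = j
      · have hj : (j : ℕ) < K := h ▸ hi
        simp [h, hj]
      · simp [h]
    · intro l _ hl
      rw [if_neg fun h => hl (Fin.ext h.symm), zero_mul]
    · simp
  · rw [Finset.sum_eq_zero fun l _ => ?_]
    · simp [hi]
    · rw [if_neg fun h : (i : ℕ) = l => hi (h ▸ l.2), zero_mul]

theorem rectDiagonal_self (N : ℕ) (s : ℕ → ℝ) :
    rectDiagonal N N s = Matrix.diagonal fun i : Fin N => ((s i : ℝ) : ℍ[ℝ]) := by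
  ext1 i j
  simp [rectDiagonal, Matrix.diagonal_apply, Fin.ext_iff]

theorem LinearMap.singularValues_fin_eq_of_charpoly_eq {𝕜 E F : Type*} [RCLike 𝕜]
    [NormedAddCommGroup E] [InnerProductSpace 𝕜 E] [FiniteDimensional 𝕜 E]
    [NormedAddCommGroup F] [InnerProductSpace 𝕜 F] [FiniteDimensional 𝕜 F]
    (T : E →ₗ[𝕜] F) {n : ℕ} (hn : Module.finrank 𝕜 E = n) (a : Fin n → ℝ) (ha : Antitone a)
    (ha0 : ∀ i, 0 ≤ a i)
    (h : (T.adjoint ∘ₗ T).charpoly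
      = ∏ i, (Polynomial.X - Polynomial.C ((a i ^ 2 : ℝ) : 𝕜))) (i : Fin n) :
    T.singularValues i = a i := by
  have h1 := T.isSymmetric_adjoint_comp_self.sort_roots_charpoly_eq_eigenvalues hn
  have h2 : (T.adjoint ∘ₗ T).charpoly.roots
      = Multiset.map (fun i => ((a i ^ 2 : ℝ) : 𝕜)) Finset.univ.val := by
    rw [h, Polynomial.roots_prod _ _ (by
      simp only [ne_eq, Finset.prod_eq_zero_iff, Polynomial.X_sub_C_ne_zero, and_false,
        exists_false, not_false_eq_true])]
    simp only [Polynomial.roots_X_sub_C, Multiset.bind_singleton]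
  have h3 : (Multiset.map (RCLike.re (K := 𝕜)) (T.adjoint ∘ₗ T).charpoly.roots).sort (· ≥ ·)
      = List.ofFn fun i => a i ^ 2 := by
    rw [h2]
    simp_rw [Fin.univ_val_map, Multiset.map_coe, List.map_ofFn, Function.comp_def,
      RCLike.ofReal_re, Multiset.coe_sort]
    convert! List.mergeSort_of_pairwise ?_
    simp_rw [decide_eq_true_eq, ← List.sortedGE_iff_pairwise]
    have : Antitone fun i => a i ^ 2 := fun i j hij => pow_le_pow_left₀ (ha0 j) (ha hij) 2
    convert! this.sortedGE_ofFn
  rw [h1, List.ofFn_inj] at h3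
  rw [T.singularValues_fin hn, congrFun h3 i, Real.sqrt_sq (ha0 i)]

theorem Finset.prod_range_two_mul_div {R : Type*} [CommMonoid R] (n : ℕ) (f : ℕ → R) :
    ∏ i ∈ Finset.range (2 * n), f (i / 2)
      = (∏ i ∈ Finset.range n, f i) * ∏ i ∈ Finset.range n, f i := by
  rw [← Finset.prod_mul_distrib]
  induction n with
  | zero => simp
  | succ n ih =>
    rw [Nat.mul_succ, Finset.prod_range_succ, Finset.prod_range_succ, ih, Finset.prod_range_succ,
      mul_assoc]
    congr 3 <;> omega

theorem Finset.sum_range_two_mul_div {R : Type*} [AddCommMonoid R] (n : ℕ) (f : ℕ → R) :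
    ∑ i ∈ Finset.range (2 * n), f (i / 2)
      = (∑ i ∈ Finset.range n, f i) + ∑ i ∈ Finset.range n, f i := by
  rw [← Finset.sum_add_distrib]
  induction n with
  | zero => simp
  | succ n ih =>
    rw [Nat.mul_succ, Finset.sum_range_succ, Finset.sum_range_succ, ih, Finset.sum_range_succ,
      add_assoc]
    congr 3 <;> omega

theorem toEuclideanLin_mul {l m n : Type*} [Fintype l] [Fintype m] [DecidableEq m] [Fintype n]
    [DecidableEq n] (A : Matrix l m ℂ) (B : Matrix m n ℂ) :
    Matrix.toEuclideanLin (A * B) = Matrix.toEuclideanLin A ∘ₗ Matrix.toEuclideanLin B := by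
  ext v i
  simp [Matrix.toEuclideanLin]

theorem charpoly_toEuclideanLin {n : Type*} [Fintype n] [DecidableEq n] (A : Matrix n n ℂ) :
    (Matrix.toEuclideanLin A).charpoly = A.charpoly := by
  rw [Matrix.toEuclideanLin, Matrix.toLpLin_eq_toLin, Matrix.charpoly_toLin]

namespace IsQSVD

variable {M N : ℕ} {X : Matrix (Fin M) (Fin N) ℍ[ℝ]} {A : Matrix (Fin M) (Fin M) ℍ[ℝ]} {s : ℕ → ℝ}
  {B : Matrix (Fin N) (Fin N) ℍ[ℝ]}

theorem conjTranspose (h : IsQSVD X A s B) : IsQSVD Xᴴ B s A where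
  unitary_left := h.unitary_right
  unitary_right := h.unitary_left
  antitone := h.antitone
  nonneg := h.nonneg
  eq_mul := by
    rw [h.eq_mul, Matrix.conjTranspose_mul, Matrix.conjTranspose_mul,
      Matrix.conjTranspose_conjTranspose, rectDiagonal_conjTranspose, Matrix.mul_assoc]

theorem charpoly (h : IsQSVD X A s B) :
    (complexRep (Xᴴ * X)).charpoly
      = ∏ i : Fin (2 * N), (Polynomial.X - Polynomial.C
          ((((if (i : ℕ) / 2 < M then s ((i : ℕ) / 2) else 0) ^ 2 : ℝ)) : ℂ)) := by
  have hA : Aᴴ * A = 1 := (Unitary.mem_iff.1 h.unitary_left).1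
  have hB : Bᴴ * B = 1 := (Unitary.mem_iff.1 h.unitary_right).1
  have h1 : Xᴴ * X = B * (rectDiagonal N M s * rectDiagonal M N s) * Bᴴ := by
    rw [h.conjTranspose.eq_mul, h.eq_mul]
    simp only [Matrix.mul_assoc]
    rw [← Matrix.mul_assoc Aᴴ A, hA, Matrix.one_mul]
  rw [h1, complexRep_mul, Matrix.charpoly_mul_comm, ← complexRep_mul, ← Matrix.mul_assoc, hB,
    Matrix.one_mul, rectDiagonal_mul, rectDiagonal_self, complexRep_diagonal,
    Matrix.charpoly_diagonal, Fintype.prod_sum_type,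
    Fin.prod_univ_eq_prod_range (fun i => Polynomial.X - Polynomial.C
      ((((if i / 2 < M then s (i / 2) else 0) ^ 2 : ℝ)) : ℂ)) (2 * N),
    Finset.prod_range_two_mul_div N fun i => (Polynomial.X - Polynomial.C
      ((((if i < M then s i else 0) ^ 2 : ℝ)) : ℂ)),
    ← Fin.prod_univ_eq_prod_range (fun i => Polynomial.X - Polynomial.C
      ((((if i < M then s i else 0) ^ 2 : ℝ)) : ℂ)) N]
  simp only [Sum.elim_inl, Sum.elim_inr]
  congr! 6 <;> split_ifs <;> ring

theorem singularValues_complexRep (h : IsQSVD X A s B) (i : ℕ) :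
    (Matrix.toEuclideanLin (complexRep X)).singularValues i
      = if i / 2 < min M N then s (i / 2) else 0 := by
  have hn : Module.finrank ℂ (EuclideanSpace ℂ (Fin N ⊕ Fin N)) = 2 * N := by
    simp [two_mul]
  by_cases hi : i < 2 * N
  · have key := (Matrix.toEuclideanLin (complexRep X)).singularValues_fin_eq_of_charpoly_eq hn
      (fun i => if (i : ℕ) / 2 < M then s ((i : ℕ) / 2) else 0) ?_ ?_ ?_ ⟨i, hi⟩
    · simp only at key
      rw [key]
      congr 1
      simp only [lt_min_iff, eq_iff_iff]
      omega
    · intro i j hij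
      have hij' : (i : ℕ) / 2 ≤ (j : ℕ) / 2 := Nat.div_le_div_right hij
      simp only
      by_cases hj : (j : ℕ) / 2 < M
      · rw [if_pos hj, if_pos (hij'.trans_lt hj)]
        exact h.antitone hij'
      · rw [if_neg hj]
        split_ifs
        exacts [h.nonneg _, le_rfl]
    · intro i
      split_ifs
      exacts [h.nonneg _, le_rfl]
    · rw [← Matrix.toEuclideanLin_conjTranspose_eq_adjoint, ← toEuclideanLin_mul,
        charpoly_toEuclideanLin, ← complexRep_conjTranspose, ← complexRep_mul]
      exact h.charpoly
  · rw [LinearMap.singularValues_of_finrank_le _ (by rw [hn]; omega), if_neg]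
    rw [lt_min_iff]
    omega

theorem quatSingularValue_eq (h : IsQSVD X A s B) (i : ℕ) :
    quatSingularValue X i = if i < min M N then s i else 0 := by
  rw [quatSingularValue, h.singularValues_complexRep]
  simp

theorem singularValues_complexRep_eq_quatSingularValue (h : IsQSVD X A s B) (i : ℕ) :
    (Matrix.toEuclideanLin (complexRep X)).singularValues i = quatSingularValue X (i / 2) := by
  rw [h.singularValues_complexRep, h.quatSingularValue_eq]

end IsQSVD

noncomputable section

/-- The squared Euclidean norm of a quaternion vector. -/
def quatNormSq {N : ℕ} (v : Fin N → ℍ[ℝ]) : ℝ := ∑ i, Quaternion.normSq (v i)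

theorem quatNormSq_nonneg {N : ℕ} (v : Fin N → ℍ[ℝ]) : 0 ≤ quatNormSq v :=
  Finset.sum_nonneg fun _ _ => Quaternion.normSq_nonneg

theorem quatNormSq_eq_zero {N : ℕ} {v : Fin N → ℍ[ℝ]} : quatNormSq v = 0 ↔ v = 0 := by
  rw [quatNormSq, Finset.sum_eq_zero_iff_of_nonneg fun _ _ => Quaternion.normSq_nonneg]
  simp [funext_iff]

theorem quatNormSq_smul {N : ℕ} (r : ℝ) (v : Fin N → ℍ[ℝ]) :
    quatNormSq (r • v) = r ^ 2 * quatNormSq v := by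
  simp [quatNormSq, Finset.mul_sum, Quaternion.normSq_smul]

theorem coe_quatNormSq {N : ℕ} (v : Fin N → ℍ[ℝ]) :
    ((quatNormSq v : ℝ) : ℍ[ℝ]) = star v ⬝ᵥ v := by
  simp only [quatNormSq, dotProduct, Pi.star_apply, Quaternion.star_mul_self]
  have h := map_sum (algebraMap ℝ ℍ[ℝ]) (fun i => Quaternion.normSq (v i)) Finset.univ
  simpa only [Quaternion.algebraMap_def] using h

theorem quatNormSq_mulVec {M N : ℕ} {B : Matrix (Fin M) (Fin N) ℍ[ℝ]} (hB : Bᴴ * B = 1)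
    (v : Fin N → ℍ[ℝ]) : quatNormSq (B *ᵥ v) = quatNormSq v := by
  have h : ((quatNormSq (B *ᵥ v) : ℝ) : ℍ[ℝ]) = ((quatNormSq v : ℝ) : ℍ[ℝ]) := by
    rw [coe_quatNormSq, coe_quatNormSq, Matrix.star_mulVec, Matrix.dotProduct_mulVec,
      Matrix.vecMul_vecMul, hB, Matrix.vecMul_one]
  exact Quaternion.coe_injective h

theorem quatNormSq_succ {N : ℕ} (v : Fin (N + 1) → ℍ[ℝ]) :
    quatNormSq v = Quaternion.normSq (v 0) + quatNormSq fun i => v i.succ := by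
  rw [quatNormSq, Fin.sum_univ_succ, quatNormSq]

theorem exists_unitary_col_zero_eq {N : ℕ} (u : Fin (N + 1) → ℍ[ℝ]) (hu : quatNormSq u = 1) :
    ∃ A ∈ unitary (Matrix (Fin (N + 1)) (Fin (N + 1)) ℍ[ℝ]), ∀ i, A i 0 = u i := by
  obtain ⟨q, r, hr, hq, hqr⟩ : ∃ (q : ℍ[ℝ]) (r : ℝ), 0 ≤ r ∧ Quaternion.normSq q = 1 ∧
      u 0 = q * (r : ℍ[ℝ]) := by
    by_cases h0 : u 0 = 0
    · exact ⟨1, 0, le_rfl, by simp, by simp [h0]⟩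
    · have hn : ‖u 0‖ ≠ 0 := norm_ne_zero_iff.2 h0
      refine ⟨u 0 * ((‖u 0‖⁻¹ : ℝ) : ℍ[ℝ]), ‖u 0‖, norm_nonneg _, ?_, ?_⟩
      · rw [map_mul, Quaternion.normSq_coe, Quaternion.normSq_eq_norm_mul_self]
        field_simp
      · rw [mul_assoc, ← Quaternion.coe_mul, inv_mul_cancel₀ hn, Quaternion.coe_one, mul_one]
  have hq1 : star q * q = 1 := by rw [Quaternion.star_mul_self, hq, Quaternion.coe_one]
  have hq2 : q * star q = 1 := by rw [Quaternion.self_mul_star, hq, Quaternion.coe_one]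
  set w : Fin (N + 1) → ℍ[ℝ] := fun i => star q * u i + if i = 0 then 1 else 0 with hw
  have hw0 : w 0 = ((r + 1 : ℝ) : ℍ[ℝ]) := by
    simp [hw, hqr, ← mul_assoc, hq1]
  have hws : ∀ i : Fin N, w i.succ = star q * u i.succ := fun i => by simp [hw]
  have hwn : quatNormSq w = 2 * (1 + r) := by
    have h1 := quatNormSq_succ u
    rw [hu, hqr, map_mul, hq, Quaternion.normSq_coe] at h1
    rw [quatNormSq_succ, hw0, Quaternion.normSq_coe]
    have h2 : quatNormSq (fun i : Fin N => w i.succ) = quatNormSq fun i : Fin N => u i.succ := by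
      simp [quatNormSq, hws, Quaternion.normSq_star, hq]
    rw [h2]
    linarith
  set P : Matrix (Fin (N + 1)) (Fin (N + 1)) ℍ[ℝ] := Matrix.of fun i j => w i * star (w j) with hP
  have hPs : Pᴴ = P := by
    ext1 i j
    simp [hP, Matrix.conjTranspose_apply]
  have hPP : P * P = (2 * (1 + r)) • P := by
    ext1 i k
    simp only [hP, Matrix.mul_apply, Matrix.of_apply, Matrix.smul_apply]
    have : ∀ j, w i * star (w j) * (w j * star (w k)) = w i * (star w j * w j) * star (w k) :=
      fun j => by simp only [Pi.star_apply, mul_assoc]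
    simp only [this]
    rw [← Finset.sum_mul, ← Finset.mul_sum]
    have h3 : ∑ j, star w j * w j = ((2 * (1 + r) : ℝ) : ℍ[ℝ]) := by
      rw [← hwn, coe_quatNormSq]; rfl
    rw [h3, ← Quaternion.coe_commutes, mul_assoc, Quaternion.coe_mul_eq_smul]
  have hr1 : (1 + r) ≠ 0 := by positivity
  set H : Matrix (Fin (N + 1)) (Fin (N + 1)) ℍ[ℝ] := (1 + r)⁻¹ • P - 1 with hH
  have hHs : Hᴴ = H := by
    have hrP : ((1 + r)⁻¹ • P)ᴴ = (1 + r)⁻¹ • Pᴴ := by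
      ext1 i j
      simp only [Matrix.conjTranspose_apply, Matrix.smul_apply, Quaternion.star_smul]
    rw [hH, Matrix.conjTranspose_sub, hrP, hPs, Matrix.conjTranspose_one]
  have hHH : H * H = 1 := by
    rw [hH, sub_mul, mul_sub, smul_mul_smul_comm, hPP, smul_smul, mul_one, one_mul]
    have : (1 + r)⁻¹ * (1 + r)⁻¹ * (2 * (1 + r)) = (1 + r)⁻¹ + (1 + r)⁻¹ := by field_simp; ring
    rw [this, add_smul]
    abel
  have hD : ∀ x y : ℍ[ℝ], x * y = 1 →
      (Matrix.diagonal fun _ => x) * (Matrix.diagonal fun _ => y)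
        = (1 : Matrix (Fin (N + 1)) (Fin (N + 1)) ℍ[ℝ]) := fun x y h => by
    rw [Matrix.diagonal_mul_diagonal, h, Matrix.diagonal_one]
  have hDs : (Matrix.diagonal fun _ => q : Matrix (Fin (N + 1)) (Fin (N + 1)) ℍ[ℝ])ᴴ
      = Matrix.diagonal fun _ => star q := by
    rw [Matrix.diagonal_conjTranspose]; rfl
  refine ⟨(Matrix.diagonal fun _ => q) * H, Unitary.mem_iff.2 ⟨?_, ?_⟩, fun i => ?_⟩
  · rw [Matrix.star_eq_conjTranspose, Matrix.conjTranspose_mul, hHs, hDs, Matrix.mul_assoc,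
      ← Matrix.mul_assoc (Matrix.diagonal _), hD _ _ hq1, Matrix.one_mul, hHH]
  · rw [Matrix.star_eq_conjTranspose, Matrix.conjTranspose_mul, hHs, hDs, Matrix.mul_assoc,
      ← Matrix.mul_assoc H, hHH, Matrix.one_mul, hD _ _ hq2]
  · rw [Matrix.diagonal_mul, hH, Matrix.sub_apply, Matrix.smul_apply, hP, Matrix.of_apply, hw0,
      Quaternion.star_coe, ← Quaternion.coe_commutes, Quaternion.coe_mul_eq_smul, smul_smul,
      add_comm r 1, inv_mul_cancel₀ hr1, one_smul, hw, Matrix.one_apply]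
    simp only [add_sub_cancel_right]
    rw [← mul_assoc, hq2, one_mul]

theorem exists_quatNormSq_mulVec_maximal {M N : ℕ} (X : Matrix (Fin M) (Fin (N + 1)) ℍ[ℝ]) :
    ∃ v, quatNormSq v = 1 ∧
      ∀ w, quatNormSq (X *ᵥ w) ≤ quatNormSq (X *ᵥ v) * quatNormSq w := by
  have hcont : ∀ n, Continuous (quatNormSq (N := n)) := fun n =>
    continuous_finsetSum _ fun i _ => Quaternion.continuous_normSq.comp (continuous_apply i)
  have hX : Continuous fun v => quatNormSq (X *ᵥ v) :=
    (hcont M).comp (continuous_const.matrix_mulVec continuous_id)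
  have hK : IsCompact {v : Fin (N + 1) → ℍ[ℝ] | quatNormSq v = 1} := by
    refine (ProperSpace.isCompact_closedBall (0 : Fin (N + 1) → ℍ[ℝ]) 1).of_isClosed_subset
      (isClosed_eq (hcont _) continuous_const) fun v hv => ?_
    rw [mem_closedBall_zero_iff, pi_norm_le_iff_of_nonneg zero_le_one]
    intro i
    have h1 : Quaternion.normSq (v i) ≤ 1 := by
      rw [← show quatNormSq v = 1 from hv]
      exact Finset.single_le_sum (f := fun i => Quaternion.normSq (v i))
        (fun _ _ => Quaternion.normSq_nonneg) (Finset.mem_univ i)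
    rw [Quaternion.normSq_eq_norm_mul_self] at h1
    nlinarith [norm_nonneg (v i)]
  obtain ⟨v, hv, hmax⟩ := hK.exists_isMaxOn ⟨Pi.single 0 1, by
    change quatNormSq (Pi.single 0 1) = 1
    rw [quatNormSq_succ]
    simp [quatNormSq]⟩ hX.continuousOn
  refine ⟨v, hv, fun w => ?_⟩
  by_cases hw : quatNormSq w = 0
  · rw [quatNormSq_eq_zero.1 hw, Matrix.mulVec_zero]
    simp [quatNormSq]
  · have hw' : 0 < quatNormSq w := (quatNormSq_nonneg w).lt_of_ne' hw
    have h1 : quatNormSq ((√(quatNormSq w))⁻¹ • w) = 1 := by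
      rw [quatNormSq_smul, inv_pow, Real.sq_sqrt hw'.le, inv_mul_cancel₀ hw]
    have h2 : quatNormSq (X *ᵥ ((√(quatNormSq w))⁻¹ • w)) ≤ quatNormSq (X *ᵥ v) := hmax h1
    rw [Matrix.mulVec_smul, quatNormSq_smul, inv_pow, Real.sq_sqrt hw'.le,
      inv_mul_le_iff₀ hw'] at h2
    linarith

/-- The block diagonal matrix with blocks `a` and `C`. -/
def consDiag {M N : ℕ} (a : ℍ[ℝ]) (C : Matrix (Fin M) (Fin N) ℍ[ℝ]) :
    Matrix (Fin (M + 1)) (Fin (N + 1)) ℍ[ℝ] :=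
  Matrix.of fun i j => Fin.cases (Fin.cases a (fun _ => 0) j)
    (fun i => Fin.cases 0 (fun j => C i j) j) i

section consDiag

variable {L M N : ℕ} (a b : ℍ[ℝ]) (C : Matrix (Fin L) (Fin M) ℍ[ℝ])
  (D : Matrix (Fin M) (Fin N) ℍ[ℝ])

@[simp] theorem consDiag_zero_zero : consDiag a C 0 0 = a := rfl
@[simp] theorem consDiag_zero_succ (j : Fin M) : consDiag a C 0 j.succ = 0 := rfl
@[simp] theorem consDiag_succ_zero (i : Fin L) : consDiag a C i.succ 0 = 0 := rfl
@[simp] theorem consDiag_succ_succ (i : Fin L) (j : Fin M) :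
    consDiag a C i.succ j.succ = C i j := rfl

theorem consDiag_mul : consDiag a C * consDiag b D = consDiag (a * b) (C * D) := by
  ext1 i j
  rw [Matrix.mul_apply, Fin.sum_univ_succ]
  refine Fin.cases ?_ (fun i => ?_) i <;> refine Fin.cases ?_ (fun j => ?_) j <;>
    simp [Matrix.mul_apply]

theorem consDiag_conjTranspose : (consDiag a C)ᴴ = consDiag (star a) Cᴴ := by
  ext1 i j
  rw [Matrix.conjTranspose_apply]
  refine Fin.cases ?_ (fun i => ?_) i <;> refine Fin.cases ?_ (fun j => ?_) j <;>
    simp [Matrix.conjTranspose_apply]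

theorem consDiag_one_one : consDiag 1 (1 : Matrix (Fin N) (Fin N) ℍ[ℝ]) = 1 := by
  ext1 i j
  refine Fin.cases ?_ (fun i => ?_) i <;> refine Fin.cases ?_ (fun j => ?_) j <;>
    simp [Matrix.one_apply, Fin.succ_ne_zero, (Fin.succ_ne_zero _).symm]

theorem consDiag_one_mem_unitary {A : Matrix (Fin N) (Fin N) ℍ[ℝ]}
    (hA : A ∈ unitary (Matrix (Fin N) (Fin N) ℍ[ℝ])) :
    consDiag 1 A ∈ unitary (Matrix (Fin (N + 1)) (Fin (N + 1)) ℍ[ℝ]) := by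
  rw [Unitary.mem_iff, Matrix.star_eq_conjTranspose] at hA ⊢
  rw [consDiag_conjTranspose, consDiag_mul, consDiag_mul, hA.1, hA.2, star_one, one_mul,
    consDiag_one_one, and_self]

theorem consDiag_rectDiagonal (M N : ℕ) (s : ℕ → ℝ) :
    consDiag (s 0 : ℍ[ℝ]) (rectDiagonal M N fun i => s (i + 1))
      = rectDiagonal (M + 1) (N + 1) s := by
  ext1 i j
  refine Fin.cases ?_ (fun i => ?_) i <;> refine Fin.cases ?_ (fun j => ?_) j <;>
    simp [rectDiagonal]

end consDiag

theorem exists_isQSVD_of_bound {M N : ℕ} (X : Matrix (Fin M) (Fin N) ℍ[ℝ]) {c : ℝ} (hc : 0 ≤ c)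
    (hX : ∀ v, quatNormSq (X *ᵥ v) ≤ c ^ 2 * quatNormSq v) :
    ∃ A s B, IsQSVD X A s B ∧ ∀ i, s i ≤ c := by
  induction M generalizing N c with
  | zero =>
    exact ⟨1, fun _ => 0, 1, ⟨one_mem _, one_mem _, antitone_const, fun _ => le_rfl,
      Matrix.ext fun i => i.elim0⟩, fun _ => hc⟩
  | succ M ih =>
    cases N with
    | zero =>
      exact ⟨1, fun _ => 0, 1, ⟨one_mem _, one_mem _, antitone_const, fun _ => le_rfl,
        Matrix.ext fun i j => j.elim0⟩, fun _ => hc⟩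
    | succ N =>
      obtain ⟨v, hv, hmax⟩ := exists_quatNormSq_mulVec_maximal X
      set σ := √(quatNormSq (X *ᵥ v)) with hσ
      have hσ0 : 0 ≤ σ := Real.sqrt_nonneg _
      have hσ2 : σ ^ 2 = quatNormSq (X *ᵥ v) := Real.sq_sqrt (quatNormSq_nonneg _)
      have hσc : σ ≤ c := by
        refine le_of_sq_le_sq ?_ hc
        simpa [hσ2, hv] using hX v
      rw [← hσ2] at hmax
      obtain ⟨B, hB, hBv⟩ := exists_unitary_col_zero_eq v hv
      obtain ⟨A, hA, hAv⟩ : ∃ A ∈ unitary (Matrix (Fin (M + 1)) (Fin (M + 1)) ℍ[ℝ]),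
          ∀ i, A i 0 * (σ : ℍ[ℝ]) = (X *ᵥ v) i := by
        by_cases h0 : σ = 0
        · refine ⟨1, one_mem _, fun i => ?_⟩
          rw [h0, zero_pow two_ne_zero, eq_comm, quatNormSq_eq_zero] at hσ2
          simp [h0, hσ2]
        · obtain ⟨A, hA, hAu⟩ := exists_unitary_col_zero_eq (σ⁻¹ • (X *ᵥ v)) (by
            rw [quatNormSq_smul, ← hσ2]; field_simp)
          refine ⟨A, hA, fun i => ?_⟩
          rw [hAu, Pi.smul_apply, ← Quaternion.coe_commutes, Quaternion.coe_mul_eq_smul, smul_smul,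
            mul_inv_cancel₀ h0, one_smul]
      have hA' := Unitary.mem_iff.1 hA
      have hB' := Unitary.mem_iff.1 hB
      rw [Matrix.star_eq_conjTranspose] at hA' hB'
      set Y := Aᴴ * X * B with hY
      have hXY : X = A * Y * Bᴴ := by
        rw [hY, Matrix.mul_assoc, Matrix.mul_assoc (Aᴴ * X), hB'.2, Matrix.mul_one,
          ← Matrix.mul_assoc, hA'.2, Matrix.one_mul]
      have hYn : ∀ w, quatNormSq (Y *ᵥ w) ≤ σ ^ 2 * quatNormSq w := by
        intro w
        rw [hY, Matrix.mul_assoc, ← Matrix.mulVec_mulVec, quatNormSq_mulVec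
          (by rw [Matrix.conjTranspose_conjTranspose]; exact hA'.2), ← Matrix.mulVec_mulVec,
          ← quatNormSq_mulVec hB'.1 w]
        exact hmax _
      have hYcol : ∀ i, Y i 0 = if i = 0 then (σ : ℍ[ℝ]) else 0 := by
        intro i
        have h1 : ∀ l, (X * B) l 0 = A l 0 * (σ : ℍ[ℝ]) := fun l => by
          rw [hAv, Matrix.mul_apply]
          simp only [hBv]
          rfl
        have h2 := congrFun (congrFun hA'.1 i) 0
        rw [hY, Matrix.mul_assoc, Matrix.mul_apply]
        simp only [h1, ← mul_assoc]
        rw [← Finset.sum_mul, ← Matrix.mul_apply, h2, Matrix.one_apply]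
        split_ifs <;> simp
      have hYrow : ∀ j : Fin N, Y 0 j.succ = 0 := by
        let w : Fin (N + 1) → ℍ[ℝ] := fun j => star (Y 0 j)
        have h1 : (Y *ᵥ w) 0 = ((quatNormSq w : ℝ) : ℍ[ℝ]) := by
          rw [coe_quatNormSq]
          simp [Matrix.mulVec, dotProduct, w]
        have h2 : quatNormSq w = σ ^ 2 + quatNormSq fun j : Fin N => w j.succ := by
          rw [quatNormSq_succ]
          simp only [w]
          rw [hYcol, if_pos rfl, Quaternion.normSq_star, Quaternion.normSq_coe]
        have h3 := hYn w
        rw [quatNormSq_succ (Y *ᵥ w), h1, Quaternion.normSq_coe] at h3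
        have h4 := quatNormSq_nonneg fun i : Fin M => (Y *ᵥ w) i.succ
        have h5 := quatNormSq_nonneg fun j : Fin N => w j.succ
        have h6 : (quatNormSq fun j : Fin N => w j.succ) = 0 := by
          rw [h2] at h3
          nlinarith [sq_nonneg σ]
        intro j
        have h7 := congrFun (quatNormSq_eq_zero.1 h6) j
        simpa [w] using h7
      set Y' : Matrix (Fin M) (Fin N) ℍ[ℝ] := Y.submatrix Fin.succ Fin.succ with hY'
      have hYc : Y = consDiag (σ : ℍ[ℝ]) Y' := by
        ext1 i j
        refine Fin.cases ?_ (fun i => ?_) i <;> refine Fin.cases ?_ (fun j => ?_) j <;>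
          simp [hYcol, hYrow, Fin.succ_ne_zero, hY']
      obtain ⟨A', s', B', hs', hs'σ⟩ := ih Y' hσ0 fun w => by
        have h1 := hYn (Fin.cons 0 w)
        rw [quatNormSq_succ (Fin.cons 0 w), quatNormSq_succ (Y *ᵥ _)] at h1
        simp only [Fin.cons_zero, Fin.cons_succ, map_zero, zero_add] at h1
        refine le_trans ?_ ((le_add_of_nonneg_left Quaternion.normSq_nonneg).trans h1)
        refine le_of_eq (congrArg _ (funext fun i => ?_))
        simp [Matrix.mulVec, dotProduct, Fin.sum_univ_succ, hY']
      let s : ℕ → ℝ := fun i => Nat.casesOn i σ s'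
      refine ⟨A * consDiag 1 A', s, B * consDiag 1 B',
        ⟨mul_mem hA (consDiag_one_mem_unitary hs'.unitary_left),
          mul_mem hB (consDiag_one_mem_unitary hs'.unitary_right), ?_, ?_, ?_⟩, ?_⟩
      · refine antitone_nat_of_succ_le fun i => ?_
        cases i with
        | zero => exact hs'σ 0
        | succ i => exact hs'.antitone (Nat.le_succ i)
      · rintro (_ | i)
        exacts [hσ0, hs'.nonneg i]
      · have hC : consDiag (σ : ℍ[ℝ]) (A' * rectDiagonal M N s' * B'ᴴ)
            = consDiag 1 A' * consDiag (σ : ℍ[ℝ]) (rectDiagonal M N s') * consDiag 1 B'ᴴ := by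
          rw [consDiag_mul, consDiag_mul, one_mul, mul_one]
        rw [hXY, hYc, hs'.eq_mul, hC, Matrix.conjTranspose_mul, consDiag_conjTranspose, star_one,
          ← consDiag_rectDiagonal M N s]
        simp only [Matrix.mul_assoc, s]
        rfl
      · rintro (_ | i)
        exacts [hσc, (hs'σ i).trans hσc]

theorem exists_isQSVD {M N : ℕ} (X : Matrix (Fin M) (Fin N) ℍ[ℝ]) :
    ∃ A s B, IsQSVD X A s B := by
  obtain ⟨c, hc, h⟩ : ∃ c, 0 ≤ c ∧ ∀ v, quatNormSq (X *ᵥ v) ≤ c ^ 2 * quatNormSq v := by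
    cases N with
    | zero => exact ⟨0, le_rfl, fun v => by simp [quatNormSq, Subsingleton.elim v 0]⟩
    | succ N =>
      obtain ⟨v, -, h⟩ := exists_quatNormSq_mulVec_maximal X
      refine ⟨√(quatNormSq (X *ᵥ v)), Real.sqrt_nonneg _, fun w => ?_⟩
      rw [Real.sq_sqrt (quatNormSq_nonneg _)]
      exact h w
  obtain ⟨A, s, B, hX, -⟩ := exists_isQSVD_of_bound X hc h
  exact ⟨A, s, B, hX⟩

end

namespace IsQSVD

variable {M N : ℕ} {X : Matrix (Fin M) (Fin N) ℍ[ℝ]} {A : Matrix (Fin M) (Fin M) ℍ[ℝ]} {s : ℕ → ℝ}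
  {B : Matrix (Fin N) (Fin N) ℍ[ℝ]}

theorem eq_zero_of_quatRank_le (h : IsQSVD X A s B) {i : ℕ} (hi : i < min M N)
    (hr : quatRank X ≤ i) : s i = 0 := by
  by_contra hs
  have hA : Aᴴ * A = 1 := (Unitary.mem_iff.1 h.unitary_left).1
  have hB : Bᴴ * B = 1 := (Unitary.mem_iff.1 h.unitary_right).1
  have hiM : i + 1 ≤ M := (lt_min_iff.1 hi).1
  have hiN : i + 1 ≤ N := (lt_min_iff.1 hi).2
  let w : Fin (i + 1) → Fin M → ℍ[ℝ] := fun j l => A l (Fin.castLE hiM j) * ((s j : ℝ) : ℍ[ℝ])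
  have hXB : X * B = A * rectDiagonal M N s := by
    rw [h.eq_mul, Matrix.mul_assoc, hB, Matrix.mul_one]
  have hw : ∀ j, w j ∈ Submodule.span ℍ[ℝ]ᵐᵒᵖ (Set.range X.col) := by
    intro j
    have hwj : w j = ∑ m, MulOpposite.op (B m (Fin.castLE hiN j)) • X.col m := by
      ext1 l
      have h1 := congrFun (congrFun hXB l) (Fin.castLE hiN j)
      rw [Matrix.mul_apply, Matrix.mul_apply, Finset.sum_eq_single (Fin.castLE hiM j)] at h1
      · rw [Finset.sum_apply]
        simp only [w, Pi.smul_apply, Matrix.col_apply, MulOpposite.smul_eq_mul_unop,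
          MulOpposite.unop_op]
        rw [h1]
        simp [rectDiagonal]
      · intro m _ hm
        have : (m : ℕ) ≠ j := fun he => hm (Fin.ext (by simpa using he))
        simp [rectDiagonal, this]
      · simp
    rw [hwj]
    exact Submodule.sum_mem _ fun m _ =>
      Submodule.smul_mem _ _ (Submodule.subset_span (Set.mem_range_self m))
  have hli : LinearIndependent ℍ[ℝ]ᵐᵒᵖ w := by
    rw [Fintype.linearIndependent_iff]
    intro g hg k
    have h0 : ∀ l, ∑ j, A l (Fin.castLE hiM j) * (((s j : ℝ) : ℍ[ℝ]) * (g j).unop) = 0 := by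
      intro l
      have := congrFun hg l
      rw [Finset.sum_apply] at this
      simpa only [w, Pi.smul_apply, Pi.zero_apply, MulOpposite.smul_eq_mul_unop, mul_assoc] using this
    have h1 : ∑ l, Aᴴ (Fin.castLE hiM k) l *
        ∑ j, A l (Fin.castLE hiM j) * (((s j : ℝ) : ℍ[ℝ]) * (g j).unop) = 0 :=
      Finset.sum_eq_zero fun l _ => by rw [h0, mul_zero]
    simp only [Finset.mul_sum] at h1
    rw [Finset.sum_comm] at h1
    simp only [← mul_assoc] at h1
    simp only [mul_assoc _ (Quaternion.coe (s _)), ← Finset.sum_mul, ← Matrix.mul_apply, hA,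
      Matrix.one_apply] at h1
    rw [Finset.sum_eq_single k] at h1
    · have hsk : ((s k : ℝ) : ℍ[ℝ]) ≠ 0 :=
        Quaternion.coe_injective.ne (((h.nonneg i).lt_of_ne' hs).trans_le (h.antitone (Nat.lt_succ_iff.1 k.2))).ne'
      rw [if_pos rfl, one_mul] at h1
      exact (MulOpposite.unop_eq_zero_iff _).1 ((mul_eq_zero.1 h1).resolve_left hsk)
    · intro j _ hj
      rw [if_neg fun he => hj (Fin.castLE_injective hiM he).symm, zero_mul]
    · simp
  have h2 := finrank_span_eq_card hli
  have hfin : FiniteDimensional ℍ[ℝ]ᵐᵒᵖ (Submodule.span ℍ[ℝ]ᵐᵒᵖ (Set.range X.col)) :=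
    FiniteDimensional.span_of_finite _ (Set.finite_range _)
  have h3 := Submodule.finrank_mono (Submodule.span_le.2 (Set.range_subset_iff.2 hw))
  rw [h2, Fintype.card_fin] at h3
  exact absurd (h3.trans hr) (by omega)

theorem mul_rectDiagonal_right (h : IsQSVD X A s B) (d : ℕ) {t : ℕ → ℝ} (ht : Antitone t)
    (ht0 : ∀ i, 0 ≤ t i) : IsQSVD (A * rectDiagonal M d t) A t 1 where
  unitary_left := h.unitary_left
  unitary_right := one_mem _
  antitone := ht
  nonneg := ht0
  eq_mul := by rw [Matrix.conjTranspose_one, Matrix.mul_one]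

theorem quatLogNorm_mul_rectDiagonal_sqrt (h : IsQSVD X A s B) {d : ℕ} (hd : d ≤ M) (ε : ℝ) :
    quatLogNorm 1 ε (A * rectDiagonal M d fun i => √(s i))
      = ∑ i ∈ Finset.range d, Real.log (√(s i) + ε) := by
  have hU := h.mul_rectDiagonal_right d (t := fun i => √(s i))
    (fun i j hij => Real.sqrt_le_sqrt (h.antitone hij)) fun _ => Real.sqrt_nonneg _
  rw [quatLogNorm, leadingLogNorm, min_eq_right hd]
  refine Finset.sum_congr rfl fun i hi => ?_
  rw [hU.quatSingularValue_eq, min_eq_right hd, if_pos (Finset.mem_range.1 hi), Real.rpow_one]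

theorem leadingLogNorm_half (h : IsQSVD X A s B) {d : ℕ} (hd : d ≤ min M N) (ε : ℝ) :
    leadingLogNorm d (1 / 2) ε X = ∑ i ∈ Finset.range d, Real.log (√(s i) + ε) := by
  refine Finset.sum_congr rfl fun i hi => ?_
  rw [h.quatSingularValue_eq, if_pos ((Finset.mem_range.1 hi).trans_le hd), Real.sqrt_eq_rpow]

theorem eq_mul_conjTranspose_sqrt (h : IsQSVD X A s B) {d : ℕ} (hX : quatRank X ≤ d) :
    X = (A * rectDiagonal M d fun i => √(s i)) * (B * rectDiagonal N d fun i => √(s i))ᴴ := by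
  have hD : rectDiagonal M N s
      = (rectDiagonal M d fun i => √(s i)) * rectDiagonal d N fun i => √(s i) := by
    rw [rectDiagonal_mul]
    ext1 i j
    simp only [rectDiagonal, Matrix.of_apply]
    by_cases hij : (i : ℕ) = j
    · rw [if_pos hij, if_pos hij]
      split_ifs with hi
      · rw [Real.mul_self_sqrt (h.nonneg _)]
      · rw [h.eq_zero_of_quatRank_le (lt_min i.2 (hij ▸ j.2)) (hX.trans (not_lt.1 hi))]
    · rw [if_neg hij, if_neg hij]
  rw [Matrix.conjTranspose_mul, rectDiagonal_conjTranspose, Matrix.mul_assoc,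
    ← Matrix.mul_assoc (rectDiagonal M d _), ← hD, ← Matrix.mul_assoc]
  exact h.eq_mul

end IsQSVD

theorem quatSingularValue_conjTranspose {M N : ℕ} (X : Matrix (Fin M) (Fin N) ℍ[ℝ]) (i : ℕ) :
    quatSingularValue Xᴴ i = quatSingularValue X i := by
  obtain ⟨A, s, B, h⟩ := exists_isQSVD X
  rw [h.quatSingularValue_eq, h.conjTranspose.quatSingularValue_eq, min_comm]

theorem singularValues_complexRep {M N : ℕ} (X : Matrix (Fin M) (Fin N) ℍ[ℝ]) (i : ℕ) :
    (Matrix.toEuclideanLin (complexRep X)).singularValues i = quatSingularValue X (i / 2) := by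
  obtain ⟨A, s, B, h⟩ := exists_isQSVD X
  exact h.singularValues_complexRep_eq_quatSingularValue i

theorem leadingLogNorm_mul_conjTranspose_le {M N d : ℕ} (hd : d ≤ min M N) {ε : ℝ} (hε : 0 < ε)
    (U : Matrix (Fin M) (Fin d) ℍ[ℝ]) (V : Matrix (Fin N) (Fin d) ℍ[ℝ]) :
    leadingLogNorm d (1 / 2) ε (U * Vᴴ)
      ≤ 1 / 2 * quatLogNorm 1 ε U + 1 / 2 * quatLogNorm 1 ε V := by
  have key := Finset.sum_log_sqrt_add_le_of_prod_le
    (x := (Matrix.toEuclideanLin (complexRep (U * Vᴴ))).singularValues)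
    (u := (Matrix.toEuclideanLin (complexRep U)).singularValues)
    (v := (Matrix.toEuclideanLin (complexRep Vᴴ)).singularValues)
    (LinearMap.singularValues_antitone _) (LinearMap.singularValues_nonneg _)
    (LinearMap.singularValues_nonneg _) (LinearMap.singularValues_nonneg _) hε (n := 2 * d)
    fun k _ => by
      rw [complexRep_mul, toEuclideanLin_mul]
      exact LinearMap.prod_singularValues_comp_le _ _ k
  simp only [singularValues_complexRep, quatSingularValue_conjTranspose] at key
  rw [Finset.sum_range_two_mul_div d fun i => Real.log (√(quatSingularValue (U * Vᴴ) i) + ε),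
    Finset.sum_range_two_mul_div d fun i => Real.log (quatSingularValue U i + ε),
    Finset.sum_range_two_mul_div d fun i => Real.log (quatSingularValue V i + ε)] at key
  rw [quatLogNorm, quatLogNorm, min_eq_right (hd.trans (min_le_left M N)),
    min_eq_right (hd.trans (min_le_right M N)), leadingLogNorm, leadingLogNorm, leadingLogNorm]
  simp only [← Real.sqrt_eq_rpow, Real.rpow_one]
  linarith

theorem quatLogNorm_sub_eq_leadingLogNorm {M N d : ℕ} (hd : d ≤ min M N) {p : ℝ} (hp : p ≠ 0)
    (ε : ℝ) (X : Matrix (Fin M) (Fin N) ℍ[ℝ]) (hX : quatRank X ≤ d) :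
    quatLogNorm p ε X - ((min M N : ℕ) - (d : ℝ)) * Real.log ε = leadingLogNorm d p ε X := by
  obtain ⟨A, s, B, h⟩ := exists_isQSVD X
  obtain ⟨k, hk⟩ := Nat.exists_eq_add_of_le hd
  have hz : ∀ i ∈ Finset.range k,
      Real.log (quatSingularValue X (d + i) ^ p + ε) = Real.log ε := by
    intro i hi
    have hi' : d + i < min M N := by
      rw [hk]
      exact Nat.add_lt_add_left (Finset.mem_range.1 hi) d
    rw [h.quatSingularValue_eq, if_pos hi',
      h.eq_zero_of_quatRank_le hi' (hX.trans (Nat.le_add_right d i)), Real.zero_rpow hp, zero_add]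
  rw [quatLogNorm, leadingLogNorm, leadingLogNorm, hk, Finset.sum_range_add,
    Finset.sum_congr rfl hz, Finset.sum_const, Finset.card_range, nsmul_eq_mul]
  push_cast
  ring

theorem theorem3 (M N d : ℕ) (hd : d ≤ min M N) (ε : ℝ) (hε : 0 < ε)
    (X : Matrix (Fin M) (Fin N) ℍ[ℝ]) (hX : quatRank X ≤ d) :
    IsLeast
      {c : ℝ | ∃ (U : Matrix (Fin M) (Fin d) ℍ[ℝ]) (V : Matrix (Fin N) (Fin d) ℍ[ℝ]),
        X = U * Vᴴ ∧ c = 1 / 2 * quatLogNorm 1 ε U + 1 / 2 * quatLogNorm 1 ε V}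
      (quatLogNorm (1 / 2) ε X - ((min M N : ℕ) - (d : ℝ)) * Real.log ε) ∧
    quatLogNorm (1 / 2) ε X - ((min M N : ℕ) - (d : ℝ)) * Real.log ε
      = leadingLogNorm d (1 / 2) ε X ∧
    (∃ A s B, IsQSVD X A s B) ∧
    ∀ A s B, IsQSVD X A s B →
      X = (A * rectDiagonal M d fun i => √(s i)) * (B * rectDiagonal N d fun i => √(s i))ᴴ ∧
      1 / 2 * quatLogNorm 1 ε (A * rectDiagonal M d fun i => √(s i))
          + 1 / 2 * quatLogNorm 1 ε (B * rectDiagonal N d fun i => √(s i))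
        = quatLogNorm (1 / 2) ε X - ((min M N : ℕ) - (d : ℝ)) * Real.log ε := by
  have hval := quatLogNorm_sub_eq_leadingLogNorm hd (by norm_num : (1 / 2 : ℝ) ≠ 0) ε X hX
  have hfac : ∀ A s B, IsQSVD X A s B →
      X = (A * rectDiagonal M d fun i => √(s i)) * (B * rectDiagonal N d fun i => √(s i))ᴴ ∧
      1 / 2 * quatLogNorm 1 ε (A * rectDiagonal M d fun i => √(s i))
          + 1 / 2 * quatLogNorm 1 ε (B * rectDiagonal N d fun i => √(s i))
        = quatLogNorm (1 / 2) ε X - ((min M N : ℕ) - (d : ℝ)) * Real.log ε := by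
    intro A s B h
    refine ⟨h.eq_mul_conjTranspose_sqrt hX, ?_⟩
    rw [hval, h.leadingLogNorm_half hd,
      h.quatLogNorm_mul_rectDiagonal_sqrt (hd.trans (min_le_left M N)),
      h.conjTranspose.quatLogNorm_mul_rectDiagonal_sqrt (hd.trans (min_le_right M N))]
    ring
  refine ⟨⟨?_, ?_⟩, hval, exists_isQSVD X, hfac⟩
  · obtain ⟨A, s, B, h⟩ := exists_isQSVD X
    exact ⟨_, _, (hfac A s B h).1, (hfac A s B h).2.symm⟩
  · rintro c ⟨U, V, hUV, rfl⟩
    rw [hval, hUV]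
    exact leadingLogNorm_mul_conjTranspose_le hd hε U V
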